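/- Let $H\neq 0$ be a real or complex Hilbert space and let $\mathrm{Pos}$ be the set of self-adjoint bounded operators $p$ on $H$ that are positive definite, i.e. $(pv,v)\ge c\|v\|^2$ for all $v$ with some $c=c(p)>0$. Equip $\mathrm{Pos}$ with the Thompson metric $$d(p,q)=\sup_{\|v\|=1}\left|\log\frac{(qv,v)}{(pv,v)}\right| .$$ A metric functional of $\mathrm{Pos}$ is an element of the closure, for pointwise convergence, of the set of functions $h_x(\cdot)=d(\cdot,x)-d(I,x)$, $x\in\mathrm{Pos}$, in $\mathbb{R}^{\mathrm{Pos}}$. Every bounded invertible operator $g$ of $H$ (with bounded inverse) acts isometrically on $\mathrm{Pos}$ by $g\cdot p=gpg^*$, and on metric functionals by $(gh)(p)=h(g^{-1}\cdot p)-h(g^{-1}\cdot I)$. Theorem. For every bounded invertible operator $g$ of $H$ there is a nonconstant metric functional $h:\mathrm{Pos}\to\mathbb{R}$ such that $$gh=h\qquad\text{and}\qquad h(gpg^*)=h(p)-\inf_{q\in\mathrm{Pos}}d(q,gqg^*)\quad\text{for all }p\in\mathrm{Pos}.$$ Moreover, the following limits exist and the equalities hold: $$\inf_{p\in\mathrm{Pos}}\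 \sup_{v\ne0}\left|\log\frac{(pg^*v,g^*v)}{(pv,v)}\right|=\lim_{n\to\infty}\frac1n\max\left\{\log\|g^ng^{*n}\|,\ \log\|(g^ng^{*n})^{-1}\|\right\},$$ $$\inf_{p\in\mathrm{Pos}}\ \log\sup_{v\ne0}\frac{(pg^*v,g^*v)}{(pv,v)}=\lim_{n\to\infty}\frac1n\log\|g^ng^{*n}\| .$$ -/

import Mathlib

open Filter Topology

section MetricCompactification

/-- The normalised distance function `h_x = d(·, x) - d(x₀, x)`. -/
noncomputable def distFunctional {X : Type*} [MetricSpace X] (x₀ x : X) : X → ℝ :=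
  fun y => dist y x - dist x₀ x

/-- The metric compactification of `X` with base point `x₀`: the closure, for pointwise
convergence, of the set of functions `h_x`. (All `h_x` are nonexpansive, and the set of
nonexpansive functions is closed in `X → ℝ`, so it does not matter in which of the two spaces the
closure is taken.) Its elements are the metric functionals of `X`. -/
def metricCompactification (X : Type*) [MetricSpace X] (x₀ : X) : Set (X → ℝ) :=
  closure (Set.range (distFunctional x₀))

/-- The action of isometries on metric functionals: `(T h)(x) = h(T⁻¹ x) - h(T⁻¹ x₀)`. -/
def isometryAct {X : Type*} [MetricSpace X] (x₀ : X) (T : X ≃ᵢ X) (h : X → ℝ) : X → ℝ :=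
  fun x => h (T.symm x) - h (T.symm x₀)

end MetricCompactification

/-- The cone `Pos` of positive definite self-adjoint bounded operators on `H`. Positive definite
is meant in the uniform sense `(p v, v) ≥ c ‖v‖²` with `c > 0`, so that `Pos` is the interior of
the cone of positive operators (equivalently, `p` is positive and invertible). -/
structure Pos (𝕜 H : Type*) [RCLike 𝕜] [NormedAddCommGroup H] [InnerProductSpace 𝕜 H]
    [CompleteSpace H] where
  /-- the underlying operator -/
  op : H →L[𝕜] H
  isSelfAdjoint : IsSelfAdjoint op
  coercive : ∃ c : ℝ, 0 < c ∧ ∀ v : H, c * ‖v‖ ^ 2 ≤ RCLike.re (inner 𝕜 (op v) v)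

namespace Pos

variable {𝕜 H : Type*} [RCLike 𝕜] [NormedAddCommGroup H] [InnerProductSpace 𝕜 H]
  [CompleteSpace H]

/-- The quadratic form `(p v, v)`, which is real since `p` is self-adjoint. -/
noncomputable def form (p : Pos 𝕜 H) (v : H) : ℝ := RCLike.re (inner 𝕜 (p.op v) v)

theorem form_pos (p : Pos 𝕜 H) {v : H} (hv : v ≠ 0) : 0 < p.form v := by
  obtain ⟨c, hc, h⟩ := p.coercive
  have h1 := h v
  have h2 : 0 < ‖v‖ := norm_pos_iff.mpr hv
  have h3 : 0 < c * ‖v‖ ^ 2 := by positivity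
  exact lt_of_lt_of_le h3 h1

theorem form_smul (p : Pos 𝕜 H) (a : 𝕜) (v : H) : p.form (a • v) = ‖a‖ ^ 2 * p.form v := by
  unfold form
  rw [map_smul, inner_smul_left, inner_smul_right, ← mul_assoc, RCLike.conj_mul,
    ← RCLike.ofReal_pow, RCLike.re_ofReal_mul]

theorem form_le (p : Pos 𝕜 H) (v : H) : p.form v ≤ ‖p.op‖ * ‖v‖ ^ 2 := by
  calc p.form v ≤ ‖p.op v‖ * ‖v‖ := re_inner_le_norm _ _
    _ ≤ (‖p.op‖ * ‖v‖) * ‖v‖ := by gcongr; exact p.op.le_opNorm v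
    _ = _ := by ring

/-- The Thompson metric `d(p, q) = sup_{‖v‖ = 1} |log ((q v, v) / (p v, v))|`. -/
noncomputable def thompson (p q : Pos 𝕜 H) : ℝ :=
  ⨆ v : {v : H // ‖v‖ = 1}, |Real.log (q.form v / p.form v)|

theorem ne_zero_of_unit (v : {v : H // ‖v‖ = 1}) : (v : H) ≠ 0 := by
  intro h
  have h2 := v.2
  rw [h, norm_zero] at h2
  exact zero_ne_one h2

theorem exists_log_bound (p : Pos 𝕜 H) :
    ∃ C : ℝ, ∀ v : {v : H // ‖v‖ = 1}, |Real.log (p.form v)| ≤ C := by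
  obtain ⟨c, hc, h⟩ := p.coercive
  refine ⟨max (Real.log ‖p.op‖) (-Real.log c), fun v => ?_⟩
  have hpos := p.form_pos (ne_zero_of_unit v)
  have h1 : p.form v ≤ ‖p.op‖ := by simpa [v.2] using p.form_le v
  have h2 : c ≤ p.form v := by simpa [v.2, form] using h v
  rw [abs_le']
  exact ⟨(Real.log_le_log hpos h1).trans (le_max_left _ _),
    (neg_le_neg (Real.log_le_log hc h2)).trans (le_max_right _ _)⟩

theorem log_div (p q : Pos 𝕜 H) {v : H} (hv : v ≠ 0) :
    Real.log (q.form v / p.form v) = Real.log (q.form v) - Real.log (p.form v) :=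
  Real.log_div (q.form_pos hv).ne' (p.form_pos hv).ne'

theorem bddAbove_thompson (p q : Pos 𝕜 H) :
    BddAbove (Set.range fun v : {v : H // ‖v‖ = 1} => |Real.log (q.form v / p.form v)|) := by
  obtain ⟨C, hC⟩ := p.exists_log_bound
  obtain ⟨D, hD⟩ := q.exists_log_bound
  refine ⟨D + C, ?_⟩
  rintro _ ⟨v, rfl⟩
  simp only [log_div p q (ne_zero_of_unit v)]
  exact (abs_sub _ _).trans (add_le_add (hD v) (hC v))

theorem le_thompson (p q : Pos 𝕜 H) {v : H} (hv : v ≠ 0) :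
    |Real.log (q.form v / p.form v)| ≤ p.thompson q := by
  have hn : ‖v‖ ≠ 0 := norm_ne_zero_iff.mpr hv
  have hu : ‖((‖v‖⁻¹ : ℝ) : 𝕜) • v‖ = 1 := by
    rw [norm_smul, RCLike.norm_ofReal, abs_inv, abs_norm, inv_mul_cancel₀ hn]
  have h := le_ciSup (bddAbove_thompson p q) ⟨((‖v‖⁻¹ : ℝ) : 𝕜) • v, hu⟩
  simp only [form_smul] at h
  rwa [mul_div_mul_left] at h
  rw [RCLike.norm_ofReal, abs_inv, abs_norm]
  exact pow_ne_zero _ (inv_ne_zero hn)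

theorem thompson_nonneg (p q : Pos 𝕜 H) : 0 ≤ p.thompson q :=
  Real.iSup_nonneg fun _ => abs_nonneg _

theorem thompson_le {p q : Pos 𝕜 H} {C : ℝ} (hC : 0 ≤ C)
    (h : ∀ v : H, v ≠ 0 → |Real.log (q.form v / p.form v)| ≤ C) : p.thompson q ≤ C :=
  Real.iSup_le (fun v => h v (ne_zero_of_unit v)) hC

theorem ext_form {p q : Pos 𝕜 H} (h : ∀ v, p.form v = q.form v) : p = q := by
  have hs : (p.op - q.op).toLinearMap.IsSymmetric :=
    ContinuousLinearMap.isSelfAdjoint_iff_isSymmetric.mp (p.isSelfAdjoint.sub q.isSelfAdjoint)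
  have hz : (p.op - q.op).toLinearMap = 0 := by
    rw [← hs.inner_map_self_eq_zero]
    intro v
    rw [← hs.coe_re_inner_apply_self v]
    have := h v
    simp only [form] at this
    simp [inner_sub_left, this]
  have ho : p.op = q.op := by
    ext v
    have := LinearMap.congr_fun hz v
    simpa [sub_eq_zero] using this
  cases p; cases q; simp_all

noncomputable instance : MetricSpace (Pos 𝕜 H) where
  dist := thompson
  dist_self p := by
    refine le_antisymm (thompson_le le_rfl fun v hv => ?_) (thompson_nonneg p p)
    simp [div_self (p.form_pos hv).ne']
  dist_comm p q := by
    unfold thompson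
    congr 1
    funext v
    rw [log_div p q (ne_zero_of_unit v), log_div q p (ne_zero_of_unit v), abs_sub_comm]
  dist_triangle p q r := by
    refine thompson_le (add_nonneg (thompson_nonneg _ _) (thompson_nonneg _ _)) fun v hv => ?_
    have h1 := le_thompson p q hv
    have h2 := le_thompson q r hv
    rw [log_div _ _ hv] at h1 h2 ⊢
    have h3 := abs_sub_le (Real.log (r.form v)) (Real.log (q.form v)) (Real.log (p.form v))
    linarith
  eq_of_dist_eq_zero {p q} h := by
    apply ext_form
    intro v
    by_cases hv : v = 0
    · simp [hv, form]
    have h1 : |Real.log (q.form v / p.form v)| ≤ 0 := (le_thompson p q hv).trans (le_of_eq h)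
    rw [log_div p q hv] at h1
    have h2 := sub_eq_zero.mp (abs_nonpos_iff.mp h1)
    exact (Real.log_injOn_pos (q.form_pos hv) (p.form_pos hv) h2).symm

/-- The identity operator, the base point of `Pos`. -/
instance : One (Pos 𝕜 H) where
  one :=
    { op := 1
      isSelfAdjoint := IsSelfAdjoint.one _
      coercive := ⟨1, one_pos, fun v => by
        rw [one_mul, one_apply_eq_self, ← norm_sq_eq_re_inner]⟩ }

/-- The operator `g p g*`. -/
noncomputable def conj (g : (H →L[𝕜] H)ˣ) (p : Pos 𝕜 H) : Pos 𝕜 H where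
  op := (g : H →L[𝕜] H) * p.op * ContinuousLinearMap.adjoint (g : H →L[𝕜] H)
  isSelfAdjoint := p.isSelfAdjoint.conjugate (g : H →L[𝕜] H)
  coercive := by
    obtain ⟨c, hc, h⟩ := p.coercive
    set a : H →L[𝕜] H := ContinuousLinearMap.adjoint (g : H →L[𝕜] H) with ha
    set b : H →L[𝕜] H := ContinuousLinearMap.adjoint ((g⁻¹ : (H →L[𝕜] H)ˣ) : H →L[𝕜] H) with hb
    have hba : b * a = 1 := by
      rw [ha, hb, ← ContinuousLinearMap.star_eq_adjoint, ← ContinuousLinearMap.star_eq_adjoint,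
        ← star_mul, Units.mul_inv, star_one]
    have hv : ∀ v : H, ‖v‖ ≤ (‖b‖ + 1) * ‖a v‖ := fun v => by
      calc ‖v‖ = ‖b (a v)‖ := by
            rw [← mul_apply_eq_comp, hba, one_apply_eq_self]
        _ ≤ ‖b‖ * ‖a v‖ := b.le_opNorm _
        _ ≤ _ := by gcongr; linarith
    have hB : 0 < ‖b‖ + 1 := by positivity
    refine ⟨c / (‖b‖ + 1) ^ 2, by positivity, fun v => ?_⟩
    have h1 := h (a v)
    have h2 : RCLike.re (inner 𝕜 (((g : H →L[𝕜] H) * p.op * a) v) v)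
        = RCLike.re (inner 𝕜 (p.op (a v)) (a v)) := by
      rw [ha, ContinuousLinearMap.adjoint_inner_right]
      rfl
    rw [h2]
    refine le_trans ?_ h1
    rw [div_mul_eq_mul_div, div_le_iff₀ (by positivity), mul_assoc]
    have h3 : ‖v‖ ^ 2 ≤ ((‖b‖ + 1) * ‖a v‖) ^ 2 := by gcongr; exact hv v
    calc c * ‖v‖ ^ 2 ≤ c * ((‖b‖ + 1) * ‖a v‖) ^ 2 := by gcongr
      _ = _ := by ring

theorem form_conj (g : (H →L[𝕜] H)ˣ) (p : Pos 𝕜 H) (v : H) :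
    (conj g p).form v = p.form (ContinuousLinearMap.adjoint (g : H →L[𝕜] H) v) := by
  unfold form
  rw [ContinuousLinearMap.adjoint_inner_right]
  rfl

/-- The action of the invertible bounded operators on `Pos` by `p ↦ g p g*`. -/
noncomputable instance : MulAction (H →L[𝕜] H)ˣ (Pos 𝕜 H) where
  smul := conj
  one_smul p := ext_form fun v => by
    change (conj 1 p).form v = _
    rw [form_conj, Units.val_one, ← ContinuousLinearMap.star_eq_adjoint, star_one]
    rfl
  mul_smul g k p := ext_form fun v => by
    change (conj (g * k) p).form v = (conj g (conj k p)).form v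
    rw [form_conj, form_conj, form_conj, Units.val_mul, ← ContinuousLinearMap.star_eq_adjoint,
      star_mul]
    rfl

theorem thompson_conj_le (g : (H →L[𝕜] H)ˣ) (p q : Pos 𝕜 H) :
    (conj g p).thompson (conj g q) ≤ p.thompson q := by
  refine thompson_le (thompson_nonneg _ _) fun v hv => ?_
  rw [form_conj, form_conj]
  apply le_thompson
  intro h0
  have h1 : (conj g p).form v = 0 := by rw [form_conj, h0]; simp [form]
  exact ((conj g p).form_pos hv).ne' h1

/-- The action is by isometries of the Thompson metric. -/
instance : IsIsometricSMul (H →L[𝕜] H)ˣ (Pos 𝕜 H) where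
  isometry_smul g := Isometry.of_dist_eq fun p q => by
    refine le_antisymm (thompson_conj_le g p q) ?_
    have h : dist (g⁻¹ • g • p) (g⁻¹ • g • q) ≤ dist (g • p) (g • q) :=
      thompson_conj_le g⁻¹ (g • p) (g • q)
    rwa [inv_smul_smul, inv_smul_smul] at h

end Pos

/-!
The argument combines a fixed point theorem for isometries in metric geometry with a geodesic
structure on `Pos`.

Call a metric space *conical* if for each weight `0 < s < 1` it has an idempotent mean `M` with
`d (M p q, M p' q') ≤ (1 - s) d (p, p') + s d (q, q')`. For an isometry `T` of such a space, the
map `x ↦ M x₀ (T x)` is an `s`-contraction, so it almost fixes some point `x`. Put `r = 1 - s` and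
let `D` be the infimum of `d (q, T q)`. Convexity of the distance gives
`d (T y, x) ≤ r d (T y, x₀) + s d (y, x)` up to a small error, for all `y`. By the triangle
inequality, `r d (y, x) ≤ d (y, T y) + O(r)`; hence `r d (x₀, x)` tends to `D` as `r` tends to `0`,
and so does `d (x, T x)`. Therefore `d (T y, x) - d (y, x)` tends to `-D` for every single `y`: the
first estimate bounds it from above, the displacement of `x` from below. Any pointwise limit of the
functions `h_x` is then a metric functional with `h (T y) = h y - D`
(`HasConicalMeans.exists_metricFunctional`), and evaluating it along an orbit shows that
`d (x₀, T ^ n x₀) / n` tends to `D` (`tendsto_dist_iterate_div`).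

On `Pos` the mean is the weighted geometric mean, taken in its integral form
`M p q = K⁻¹ ∫ e ^ (s x) (p⁻¹ + e ^ x q⁻¹)⁻¹ dx`. From this formula it is visibly increasing in both
arguments, homogeneous of degrees `1 - s` and `s`, and idempotent after the normalisation `K`; this
is all that is needed for conicality (`Pos.hasConicalMeans`). The formula uses neither functional
calculus nor complex scalars, so it serves real and complex Hilbert spaces alike.

No metric functional of `Pos` is constant, because `max (h e) (h e⁻¹) ≥ 1` for the scalar operators
`e` and `e⁻¹` (`Pos.exists_ne_of_mem_metricCompactification`). The first limit is the translation
number of `g`, since `d (1, k k*)` is the larger of `log ‖k k*‖` and `log ‖(k k*)⁻¹‖`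
(`Pos.dist_one_smul_one`). The second one is the spectral radius formula with equivalent Hilbert
norms (`Pos.tendsto_log_norm_pow`): the sequence `log ‖g ^ n g* ^ n‖` is subadditive, the form
`p = ∑ k < n, e ^ (-k σ) g ^ k g* ^ k` with `σ = log ‖g ^ n g* ^ n‖ / n` satisfies
`g p g* ≤ e ^ σ p`, and conversely `g p g* ≤ S p` iterates to `‖g ^ n g* ^ n‖ = O(S ^ n)`.
-/

open Filter Topology

/-! ### Metric functionals of spaces with conical means -/

/-- A contraction of a nonempty metric space has points that it almost fixes; no completeness is
needed for this. -/
theorem exists_dist_map_le_of_contraction {X : Type*} [MetricSpace X] (x₀ : X) {F : X → X} {s : ℝ}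
    (hs0 : 0 ≤ s) (hs1 : s < 1) (hF : ∀ x y, dist (F x) (F y) ≤ s * dist x y) {ε : ℝ}
    (hε : 0 < ε) : ∃ x, dist x (F x) ≤ ε := by
  have h : ∀ n : ℕ, dist (F^[n] x₀) (F (F^[n] x₀)) ≤ s ^ n * dist x₀ (F x₀) := by
    intro n
    induction n with
    | zero => simp
    | succ n ih =>
      rw [Function.iterate_succ_apply', pow_succ']
      calc _ ≤ s * dist (F^[n] x₀) (F (F^[n] x₀)) := hF _ _
        _ ≤ s * (s ^ n * dist x₀ (F x₀)) := by gcongr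
        _ = _ := by ring
  have ht : Tendsto (fun n : ℕ => s ^ n * dist x₀ (F x₀)) atTop (𝓝 0) := by
    simpa using (tendsto_pow_atTop_nhds_zero_of_lt_one hs0 hs1).mul_const (dist x₀ (F x₀))
  obtain ⟨n, hn⟩ := (ht.eventually (gt_mem_nhds hε)).exists
  exact ⟨_, (h n).trans hn.le⟩

/-- Conical means: for each weight `0 < s < 1` there is an idempotent mean `M p q`, standing for
the point that divides a geodesic from `p` to `q` in the ratio `s : 1 - s`, such that the distance
is convex along pairs of these geodesics. -/
def HasConicalMeans (X : Type*) [MetricSpace X] : Prop :=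
  ∀ s ∈ Set.Ioo (0 : ℝ) 1, ∃ M : X → X → X, (∀ z, M z z = z) ∧
    ∀ p q p' q', dist (M p q) (M p' q') ≤ (1 - s) * dist p p' + s * dist q q'

theorem displacement_bddBelow {X : Type*} [MetricSpace X] (T : X → X) :
    BddBelow (Set.range fun q => dist q (T q)) :=
  ⟨0, by rintro _ ⟨q, rfl⟩; exact dist_nonneg⟩

/-- The estimates satisfied by a point `x` that the contraction `x ↦ M x₀ (T x)` almost fixes, for
the mean `M` of weight `1 - r`. -/
theorem HasConicalMeans.exists_almost_fixed {X : Type*} [MetricSpace X]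
    (hX : HasConicalMeans X) (x₀ : X) (T : X ≃ᵢ X) {r : ℝ} (hr : r ∈ Set.Ioo (0 : ℝ) 1) :
    ∃ x, (∀ y, dist (T y) x ≤ r * dist (T y) x₀ + (1 - r) * dist y x + r) ∧
      dist x (T x) ≤ r * (dist x₀ x + (dist x₀ (T x₀) + 1)) := by
  have hs : 1 - r ∈ Set.Ioo (0 : ℝ) 1 := ⟨by linarith [hr.2], by linarith [hr.1]⟩
  obtain ⟨M, hMself, hM⟩ := hX _ hs
  have hF : ∀ x y, dist (M x₀ (T x)) (M x₀ (T y)) ≤ (1 - r) * dist x y := by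
    intro x y
    simpa [T.dist_eq] using hM x₀ (T x) x₀ (T y)
  obtain ⟨x, hx⟩ := exists_dist_map_le_of_contraction x₀ hs.1.le hs.2 hF hr.1
  refine ⟨x, fun y => ?_, ?_⟩
  · have h1 := hM (T y) (T y) x₀ (T x)
    rw [hMself, T.dist_eq] at h1
    have h2 := dist_triangle_right (T y) x (M x₀ (T x))
    linarith
  · have h1 := hM x₀ (T x) (T x) (T x)
    rw [hMself, dist_self] at h1
    have h2 := dist_triangle x (M x₀ (T x)) (T x)
    have h3 := dist_triangle x₀ (T x₀) (T x)
    rw [T.dist_eq] at h3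
    have := mul_le_mul_of_nonneg_left h3 hr.1.le
    linarith

/-- The metric fixed point theorem: an isometry of a space with conical means moves some metric
functional by its minimal displacement. The functional is a limit of the `h_x` along the almost
fixed points `x` of the contractions `x ↦ M x₀ (T x)`, as the weight of the mean `M` tends to `1`. -/
theorem HasConicalMeans.exists_metricFunctional {X : Type*} [MetricSpace X]
    (hX : HasConicalMeans X) (x₀ : X) (T : X ≃ᵢ X) :
    ∃ h ∈ metricCompactification X x₀, ∀ p, h (T p) = h p - ⨅ q, dist q (T q) := by
  have : Nonempty X := ⟨x₀⟩
  set D := ⨅ q, dist q (T q) with hD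
  have hDle : ∀ q, D ≤ dist q (T q) := ciInf_le (displacement_bddBelow T)
  set r : ℕ → ℝ := fun n => 1 / ((n : ℝ) + 2) with hr
  have hrI : ∀ n, r n ∈ Set.Ioo (0 : ℝ) 1 := fun n => by
    have : (0 : ℝ) ≤ n := n.cast_nonneg
    refine ⟨by simp only [hr]; positivity, ?_⟩
    simp only [hr]
    rw [div_lt_one (by positivity)]
    linarith
  have hr0 : Tendsto r atTop (𝓝 0) := by
    have := (tendsto_one_div_add_atTop_nhds_zero_nat (𝕜 := ℝ)).comp (tendsto_add_atTop_nat 1)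
    refine this.congr fun n => ?_
    simp only [Function.comp, hr]
    push_cast
    ring
  choose x hx1 hx2 using fun n => hX.exists_almost_fixed x₀ T (hrI n)
  set e : ℕ → ℝ := fun n => r n * dist x₀ (x n) with he
  have heD : Tendsto e atTop (𝓝 D) := by
    rw [tendsto_order]
    constructor
    · intro a ha
      have ht : Tendsto (fun n => D - r n * (dist x₀ (T x₀) + 1)) atTop (𝓝 D) := by
        simpa using (hr0.mul_const (dist x₀ (T x₀) + 1)).const_sub D
      filter_upwards [ht.eventually (lt_mem_nhds ha)] with n hn
      have h1 := hx2 n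
      have h2 := hDle (x n)
      simp only [he]
      linarith
    · intro a ha
      obtain ⟨q, hq⟩ := exists_lt_of_ciInf_lt ha
      have ht : Tendsto (fun n => dist q (T q) + r n * (dist (T q) x₀ + 1 + dist x₀ q)) atTop
          (𝓝 (dist q (T q))) := by
        simpa using (hr0.mul_const (dist (T q) x₀ + 1 + dist x₀ q)).const_add (dist q (T q))
      filter_upwards [ht.eventually (gt_mem_nhds hq)] with n hn
      have h1 := hx1 n q
      have h2 := dist_triangle q (T q) (x n)
      have h3 := mul_le_mul_of_nonneg_left (dist_triangle x₀ q (x n)) (hrI n).1.le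
      simp only [he]
      linarith
  set u : ℕ → X → ℝ := fun n => distFunctional x₀ (x n) with hu
  have hinc : ∀ p, Tendsto (fun n => u n (T p) - u n p) atTop (𝓝 (-D)) := by
    intro p
    refine tendsto_of_tendsto_of_tendsto_of_le_of_le
      (g := fun n => -e n - r n * (dist x₀ (T x₀) + 1))
      (h := fun n => -e n + r n * (dist (T p) x₀ + 1 + dist p x₀)) ?_ ?_ ?_ ?_
    · simpa using heD.neg.sub (hr0.mul_const (dist x₀ (T x₀) + 1))
    · simpa using heD.neg.add (hr0.mul_const (dist (T p) x₀ + 1 + dist p x₀))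
    · intro n
      have h1 := hx2 n
      have h2 := dist_triangle_right (T p) (T (x n)) (x n)
      rw [T.dist_eq, dist_comm (T (x n))] at h2
      simp only [hu, he, distFunctional]
      linarith
    · intro n
      have h1 := hx1 n p
      have h3 := mul_le_mul_of_nonneg_left (dist_triangle_left x₀ (x n) p) (hrI n).1.le
      simp only [hu, he, distFunctional]
      linarith
  have hcpt : IsCompact (Set.univ.pi fun y : X => Set.Icc (-dist y x₀) (dist y x₀)) :=
    isCompact_univ_pi fun y => isCompact_Icc
  have hmem : ∀ n, u n ∈ Set.univ.pi fun y : X => Set.Icc (-dist y x₀) (dist y x₀) := by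
    intro n y _
    have h1 := dist_triangle y x₀ (x n)
    have h2 := dist_triangle_left x₀ (x n) y
    simp only [hu, distFunctional]
    constructor <;> linarith
  obtain ⟨h, -, hh⟩ := hcpt.ultrafilter_le_nhds ((hyperfilter ℕ).map u)
    (by rw [Ultrafilter.coe_map, le_principal_iff, mem_map]; exact univ_mem' hmem)
  have hh' : Tendsto u (hyperfilter ℕ : Filter ℕ) (𝓝 h) := hh
  have hle : (hyperfilter ℕ : Filter ℕ) ≤ atTop := Nat.hyperfilter_le_atTop
  refine ⟨h, mem_closure_of_tendsto hh' (Eventually.of_forall fun n => ⟨x n, rfl⟩), fun p => ?_⟩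
  rw [tendsto_pi_nhds] at hh'
  have := tendsto_nhds_unique ((hh' (T p)).sub (hh' p)) ((hinc p).mono_left hle)
  linarith

theorem metricCompactification_sub_le_dist {X : Type*} [MetricSpace X] {x₀ : X} {h : X → ℝ}
    (hh : h ∈ metricCompactification X x₀) (p q : X) : h p - h q ≤ dist p q := by
  have hc : IsClosed {f : X → ℝ | f p - f q ≤ dist p q} :=
    isClosed_le (by fun_prop) continuous_const
  refine closure_minimal ?_ hc hh
  rintro _ ⟨x, rfl⟩
  have := dist_triangle p q x
  simp only [distFunctional, Set.mem_ofPred_eq]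
  linarith

theorem metricCompactification_apply_base {X : Type*} [MetricSpace X] {x₀ : X} {h : X → ℝ}
    (hh : h ∈ metricCompactification X x₀) : h x₀ = 0 := by
  have hc : IsClosed {f : X → ℝ | f x₀ = 0} := isClosed_eq (by fun_prop) continuous_const
  refine closure_minimal ?_ hc hh
  rintro _ ⟨x, rfl⟩
  simp [distFunctional]

theorem dist_iterate_iterate {X : Type*} [MetricSpace X] (T : X ≃ᵢ X) (n : ℕ) (p q : X) :
    dist (T^[n] p) (T^[n] q) = dist p q := by
  induction n with
  | zero => rfl
  | succ n ih => rw [Function.iterate_succ_apply', Function.iterate_succ_apply', T.dist_eq, ih]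

theorem dist_iterate_le_add {X : Type*} [MetricSpace X] (T : X ≃ᵢ X) (x₀ q : X) (n : ℕ) :
    dist x₀ (T^[n] x₀) ≤ 2 * dist x₀ q + n * dist q (T q) := by
  have h1 : dist q (T^[n] q) ≤ n * dist q (T q) := by
    induction n with
    | zero => simp
    | succ n ih =>
      have h2 := dist_triangle q (T^[n] q) (T^[n + 1] q)
      rw [Function.iterate_succ_apply, dist_iterate_iterate] at h2
      rw [Function.iterate_succ_apply]
      push_cast
      linarith
  have h2 := dist_triangle4 x₀ q (T^[n] q) (T^[n] x₀)
  rw [dist_iterate_iterate, dist_comm q x₀] at h2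
  linarith

/-- The translation number of an isometry is its minimal displacement, once some metric functional
is moved by exactly the minimal displacement. -/
theorem tendsto_dist_iterate_div {X : Type*} [MetricSpace X] {x₀ : X} (T : X ≃ᵢ X) {h : X → ℝ}
    (hh : h ∈ metricCompactification X x₀) (hT : ∀ p, h (T p) = h p - ⨅ q, dist q (T q)) :
    Tendsto (fun n : ℕ => (1 / (n : ℝ)) * dist x₀ (T^[n] x₀)) atTop
      (𝓝 (⨅ q, dist q (T q))) := by
  have : Nonempty X := ⟨x₀⟩
  set D := ⨅ q, dist q (T q) with hD
  have hi : ∀ n : ℕ, h (T^[n] x₀) = -(n * D) := by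
    intro n
    induction n with
    | zero => simpa using metricCompactification_apply_base hh
    | succ n ih =>
      rw [Function.iterate_succ_apply', hT, ih]
      push_cast
      ring
  rw [tendsto_order]
  constructor
  · intro a ha
    filter_upwards [eventually_gt_atTop 0] with n hn
    have hn' : (0 : ℝ) < n := by exact_mod_cast hn
    have h1 := metricCompactification_sub_le_dist hh x₀ (T^[n] x₀)
    rw [hi, metricCompactification_apply_base hh] at h1
    refine ha.trans_le ?_
    rw [one_div_mul_eq_div, le_div_iff₀ hn']
    linarith
  · intro a ha
    obtain ⟨q, hq⟩ := exists_lt_of_ciInf_lt ha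
    have ht : Tendsto (fun n : ℕ => 2 * dist x₀ q * (1 / (n : ℝ)) + dist q (T q)) atTop
        (𝓝 (dist q (T q))) := by
      simpa using ((tendsto_one_div_atTop_nhds_zero_nat (𝕜 := ℝ)).const_mul
        (2 * dist x₀ q)).add_const (dist q (T q))
    filter_upwards [ht.eventually (gt_mem_nhds hq), eventually_gt_atTop 0] with n hn hn0
    have hn' : (0 : ℝ) < n := by exact_mod_cast hn0
    refine lt_of_le_of_lt ?_ hn
    rw [one_div_mul_eq_div, div_le_iff₀ hn']
    have := dist_iterate_le_add T x₀ q n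
    field_simp
    linarith

/-! ### Inverses, sums and dilations in `Pos` -/

namespace Pos

variable {𝕜 H : Type*} [RCLike 𝕜] [NormedAddCommGroup H] [InnerProductSpace 𝕜 H]
  [CompleteSpace H]

theorem ext_op {p q : Pos 𝕜 H} (h : p.op = q.op) : p = q := by
  cases p; cases q; simp_all

theorem form_nonneg (p : Pos 𝕜 H) (v : H) : 0 ≤ p.form v := by
  obtain ⟨c, hc, h⟩ := p.coercive
  exact le_trans (by positivity) (h v)

theorem isUnit_op (p : Pos 𝕜 H) : IsUnit p.op := by
  obtain ⟨c, hc, h⟩ := p.coercive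
  refine ContinuousLinearMap.isUnit_of_forall_le_norm_inner_map p.op (c := ⟨c, hc.le⟩) hc
    fun v => ?_
  rw [mul_comm]
  exact (h v).trans (RCLike.re_le_norm _)

noncomputable instance : Inv (Pos 𝕜 H) where
  inv p :=
    { op := Ring.inverse p.op
      isSelfAdjoint := p.isSelfAdjoint.ringInverse
      coercive := by
        obtain ⟨c, hc, h⟩ := p.coercive
        refine ⟨c / (‖p.op‖ + 1) ^ 2, by positivity, fun v => ?_⟩
        have hv : p.op (Ring.inverse p.op v) = v := by
          rw [← mul_apply_eq_comp, Ring.mul_inverse_cancel _ p.isUnit_op, one_apply_eq_self]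
        set w := Ring.inverse p.op v
        have h1 : ‖v‖ ≤ (‖p.op‖ + 1) * ‖w‖ := by
          rw [← hv]
          exact (p.op.le_opNorm w).trans (by gcongr; linarith)
        have h2 : RCLike.re (inner 𝕜 w v) = RCLike.re (inner 𝕜 (p.op w) w) := by
          rw [hv, inner_re_symm]
        rw [h2]
        refine le_trans ?_ (h w)
        rw [div_mul_eq_mul_div, div_le_iff₀ (by positivity), mul_assoc]
        calc c * ‖v‖ ^ 2 ≤ c * ((‖p.op‖ + 1) * ‖w‖) ^ 2 := by gcongr
          _ = _ := by ring }

theorem op_inv (p : Pos 𝕜 H) : p⁻¹.op = Ring.inverse p.op := rfl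

theorem op_op_inv (p : Pos 𝕜 H) (v : H) : p.op (p⁻¹.op v) = v := by
  rw [op_inv, ← mul_apply_eq_comp, Ring.mul_inverse_cancel _ p.isUnit_op, one_apply_eq_self]

theorem inv_eq_of_mul_eq_one {p q : Pos 𝕜 H} (h : p.op * q.op = 1) : p⁻¹ = q := by
  apply ext_op
  rw [op_inv, ← mul_one (Ring.inverse p.op), ← h, ← mul_assoc,
    Ring.inverse_mul_cancel _ p.isUnit_op, one_mul]

theorem op_mul_inv (p : Pos 𝕜 H) : p.op * p⁻¹.op = 1 := Ring.mul_inverse_cancel _ p.isUnit_op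

theorem inv_op_mul (p : Pos 𝕜 H) : p⁻¹.op * p.op = 1 := Ring.inverse_mul_cancel _ p.isUnit_op

theorem inv_inv_eq (p : Pos 𝕜 H) : p⁻¹⁻¹ = p := inv_eq_of_mul_eq_one p.inv_op_mul

instance : Add (Pos 𝕜 H) where
  add p q :=
    { op := p.op + q.op
      isSelfAdjoint := p.isSelfAdjoint.add q.isSelfAdjoint
      coercive := by
        obtain ⟨c, hc, h⟩ := p.coercive
        obtain ⟨d, hd, h'⟩ := q.coercive
        refine ⟨c + d, by positivity, fun v => ?_⟩
        rw [add_apply, inner_add_left, map_add, add_mul]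
        exact add_le_add (h v) (h' v) }

theorem op_add (p q : Pos 𝕜 H) : (p + q).op = p.op + q.op := rfl

theorem form_add (p q : Pos 𝕜 H) (v : H) : (p + q).form v = p.form v + q.form v := by
  unfold form
  rw [op_add, add_apply, inner_add_left, map_add]

/-- The operator `e ^ a • p`. Scaling by the exponential of a real number keeps positivity without
a side condition. -/
noncomputable def dil (a : ℝ) (p : Pos 𝕜 H) : Pos 𝕜 H where
  op := ((Real.exp a : ℝ) : 𝕜) • p.op
  isSelfAdjoint := by
    refine IsSelfAdjoint.smul ?_ p.isSelfAdjoint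
    rw [isSelfAdjoint_iff, RCLike.star_def, RCLike.conj_ofReal]
  coercive := by
    obtain ⟨c, hc, h⟩ := p.coercive
    refine ⟨Real.exp a * c, by positivity, fun v => ?_⟩
    rw [smul_apply, inner_smul_left, RCLike.conj_ofReal, RCLike.re_ofReal_mul, mul_assoc]
    gcongr
    exact h v

theorem op_dil (a : ℝ) (p : Pos 𝕜 H) : (dil a p).op = ((Real.exp a : ℝ) : 𝕜) • p.op := rfl

theorem form_dil (a : ℝ) (p : Pos 𝕜 H) (v : H) : (dil a p).form v = Real.exp a * p.form v := by
  unfold form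
  rw [op_dil, smul_apply, inner_smul_left, RCLike.conj_ofReal, RCLike.re_ofReal_mul]

theorem dil_dil (a b : ℝ) (p : Pos 𝕜 H) : dil a (dil b p) = dil (a + b) p :=
  ext_form fun v => by simp only [form_dil, Real.exp_add]; ring

theorem dil_add (a : ℝ) (p q : Pos 𝕜 H) : dil a (p + q) = dil a p + dil a q :=
  ext_form fun v => by simp only [form_dil, form_add]; ring

theorem inv_dil (a : ℝ) (p : Pos 𝕜 H) : (dil a p)⁻¹ = dil (-a) p⁻¹ := by
  apply inv_eq_of_mul_eq_one
  rw [op_dil, op_dil, smul_mul_smul_comm, op_mul_inv, ← RCLike.ofReal_mul, ← Real.exp_add,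
    add_neg_cancel, Real.exp_zero, RCLike.ofReal_one, one_smul]

/-- Inversion reverses the order of the forms: complete the square in `p (w - p⁻¹ v)`, for
`w = q⁻¹ v`. -/
theorem form_inv_le {p q : Pos 𝕜 H} (h : ∀ v, p.form v ≤ q.form v) (v : H) :
    q⁻¹.form v ≤ p⁻¹.form v := by
  set w := q⁻¹.op v with hw
  set u := p⁻¹.op v with hu
  have hqw : q.op w = v := q.op_op_inv v
  have hpu : p.op u = v := p.op_op_inv v
  have h0 : 0 ≤ p.form (w - u) := p.form_nonneg _
  have h1 : p.form (w - u) = p.form w - 2 * q⁻¹.form v + p⁻¹.form v := by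
    have hsym : inner 𝕜 (p.op w) u = inner 𝕜 w (p.op u) :=
      ContinuousLinearMap.isSelfAdjoint_iff_isSymmetric.mp p.isSelfAdjoint w u
    have e1 : RCLike.re (inner 𝕜 v w) = q⁻¹.form v := by
      rw [inner_re_symm]; rfl
    have e2 : RCLike.re (inner 𝕜 v u) = p⁻¹.form v := by
      rw [inner_re_symm]; rfl
    have e3 : RCLike.re (inner 𝕜 w v) = q⁻¹.form v := rfl
    unfold form at e1 e2 e3 ⊢
    rw [map_sub, inner_sub_left, inner_sub_right, inner_sub_right, hsym, hpu]
    simp only [map_sub, e1, e2, e3]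
    ring
  have h2 : q.form w = q⁻¹.form v := by
    unfold form
    rw [hqw, inner_re_symm]
  have h3 := h w
  linarith

theorem norm_inv_op_le {p : Pos 𝕜 H} {c : ℝ} (hc : 0 < c) (h : ∀ v, c * ‖v‖ ^ 2 ≤ p.form v) :
    ‖p⁻¹.op‖ ≤ c⁻¹ := by
  refine ContinuousLinearMap.opNorm_le_bound _ (by positivity) fun v => ?_
  have h1 := h (p⁻¹.op v)
  have h2 : p.form (p⁻¹.op v) ≤ ‖v‖ * ‖p⁻¹.op v‖ := by
    unfold form
    rw [op_op_inv]
    exact re_inner_le_norm _ _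
  rcases (norm_nonneg (p⁻¹.op v)).eq_or_lt with h0 | h0
  · rw [← h0]; positivity
  · rw [inv_mul_eq_div, le_div_iff₀ hc]
    nlinarith

/-- The Thompson distance through the order: `p ≤ e ^ d(p, q) q`. -/
theorem form_le_exp_dist (p q : Pos 𝕜 H) (v : H) :
    p.form v ≤ Real.exp (dist p q) * q.form v := by
  by_cases hv : v = 0
  · simp [hv, form]
  have h := (abs_le.mp (le_thompson p q hv)).1
  rw [log_div p q hv] at h
  have h' : Real.log (p.form v) ≤ dist p q + Real.log (q.form v) := by
    change _ ≤ p.thompson q + _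
    linarith
  calc p.form v = Real.exp (Real.log (p.form v)) := (Real.exp_log (p.form_pos hv)).symm
    _ ≤ Real.exp (dist p q + Real.log (q.form v)) := Real.exp_le_exp.mpr h'
    _ = _ := by rw [Real.exp_add, Real.exp_log (q.form_pos hv)]

theorem dist_le_of_form_le {p q : Pos 𝕜 H} {C : ℝ} (hC : 0 ≤ C)
    (h1 : ∀ v, p.form v ≤ Real.exp C * q.form v) (h2 : ∀ v, q.form v ≤ Real.exp C * p.form v) :
    dist p q ≤ C := by
  refine thompson_le hC fun v hv => ?_
  have hp := p.form_pos hv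
  have hq := q.form_pos hv
  have l1 := Real.log_le_log hp (h1 v)
  have l2 := Real.log_le_log hq (h2 v)
  rw [Real.log_mul (Real.exp_pos _).ne' hq.ne', Real.log_exp] at l1
  rw [Real.log_mul (Real.exp_pos _).ne' hp.ne', Real.log_exp] at l2
  rw [log_div p q hv, abs_le]
  constructor <;> linarith

/-! ### Weighted geometric means -/

/-- The integrand `e ^ (s x) (p⁻¹ + e ^ x q⁻¹)⁻¹` of the geometric mean. -/
noncomputable def meanIntegrand (s : ℝ) (p q : Pos 𝕜 H) (x : ℝ) : Pos 𝕜 H :=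
  dil (s * x) (p⁻¹ + dil x q⁻¹)⁻¹

theorem meanIntegrand_mono (s : ℝ) {p q p' q' : Pos 𝕜 H} (hp : ∀ v, p.form v ≤ p'.form v)
    (hq : ∀ v, q.form v ≤ q'.form v) (x : ℝ) (v : H) :
    (meanIntegrand s p q x).form v ≤ (meanIntegrand s p' q' x).form v := by
  unfold meanIntegrand
  rw [form_dil, form_dil]
  gcongr
  refine form_inv_le (fun w => ?_) v
  rw [form_add, form_add, form_dil, form_dil]
  gcongr
  · exact form_inv_le hp w
  · exact form_inv_le hq w

theorem meanIntegrand_dil (s a b : ℝ) (p q : Pos 𝕜 H) (x : ℝ) :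
    meanIntegrand s (dil b p) (dil a q) x =
      dil ((1 - s) * b + s * a) (meanIntegrand s p q (x + (b - a))) := by
  have h : (dil b p)⁻¹ + dil x (dil a q)⁻¹ = dil (-b) (p⁻¹ + dil (x + (b - a)) q⁻¹) := by
    rw [inv_dil, inv_dil, dil_add, dil_dil, dil_dil]
    congr 2
    ring
  unfold meanIntegrand
  rw [h, inv_dil, dil_dil, dil_dil]
  congr 1
  ring

theorem meanIntegrand_self (s : ℝ) (z : Pos 𝕜 H) (x : ℝ) :
    meanIntegrand s z z x = dil (s * x - Real.log (1 + Real.exp x)) z := by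
  have h : z⁻¹ + dil x z⁻¹ = dil (Real.log (1 + Real.exp x)) z⁻¹ := ext_form fun v => by
    rw [form_add, form_dil, form_dil, Real.exp_log (by positivity)]
    ring
  unfold meanIntegrand
  rw [h, inv_dil, inv_inv_eq, dil_dil, sub_eq_add_neg]

theorem continuous_meanIntegrand (s : ℝ) (p q : Pos 𝕜 H) :
    Continuous fun x => (meanIntegrand s p q x).op := by
  have h : Continuous fun x : ℝ => (p⁻¹ + dil x q⁻¹).op := by
    simp only [op_add, op_dil]
    fun_prop
  have h2 : Continuous fun x : ℝ => Ring.inverse (p⁻¹ + dil x q⁻¹).op := by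
    rw [continuous_iff_continuousAt]
    intro x
    obtain ⟨u, hu⟩ := (p⁻¹ + dil x q⁻¹).isUnit_op
    have := NormedRing.inverse_continuousAt u
    rw [hu] at this
    exact ContinuousAt.comp (f := fun x : ℝ => (p⁻¹ + dil x q⁻¹).op) this h.continuousAt
  unfold meanIntegrand
  simp only [op_dil, op_inv] at h2 ⊢
  fun_prop

theorem exists_norm_meanIntegrand_le (s : ℝ) (p q : Pos 𝕜 H) :
    ∃ C, ∀ x, ‖(meanIntegrand s p q x).op‖ ≤ C * Real.exp (-min s (1 - s) * |x|) := by
  obtain ⟨c, hc, hcp⟩ := p⁻¹.coercive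
  obtain ⟨d, hd, hdq⟩ := q⁻¹.coercive
  refine ⟨max c⁻¹ d⁻¹, fun x => ?_⟩
  have h : ‖(meanIntegrand s p q x).op‖ ≤ Real.exp (s * x) * (c + Real.exp x * d)⁻¹ := by
    unfold meanIntegrand
    rw [op_dil, norm_smul, RCLike.norm_ofReal, abs_of_pos (Real.exp_pos _)]
    gcongr
    refine norm_inv_op_le (by positivity) fun v => ?_
    rw [form_add, form_dil, add_mul, mul_assoc]
    gcongr
    exacts [hcp v, hdq v]
  refine h.trans ?_
  rcases le_total x 0 with hx | hx
  · rw [abs_of_nonpos hx, mul_comm]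
    have h1 : s * x ≤ -min s (1 - s) * -x := by nlinarith [min_le_left s (1 - s)]
    refine mul_le_mul ?_ (Real.exp_le_exp.mpr h1) (Real.exp_pos _).le (by positivity)
    refine le_trans ?_ (le_max_left _ _)
    gcongr
    have : 0 < Real.exp x * d := by positivity
    linarith
  · rw [abs_of_nonneg hx]
    have h1 : Real.exp (s * x) * (c + Real.exp x * d)⁻¹ ≤
        Real.exp (s * x) * (Real.exp x * d)⁻¹ := by
      gcongr
      linarith
    refine h1.trans ?_
    rw [mul_inv, ← mul_assoc, ← Real.exp_neg, ← Real.exp_add, mul_comm]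
    gcongr
    · exact le_max_right _ _
    · nlinarith [min_le_right s (1 - s)]

end Pos

theorem integrable_exp_neg_mul_abs_real {m : ℝ} (hm : 0 < m) :
    MeasureTheory.Integrable fun x : ℝ => Real.exp (-m * |x|) := by
  rw [← MeasureTheory.integrableOn_univ, ← Set.Iic_union_Ioi (a := (0 : ℝ))]
  refine MeasureTheory.IntegrableOn.union ?_ ?_
  · refine (integrableOn_exp_mul_Iic hm 0).congr_fun (fun x hx => ?_) measurableSet_Iic
    simp [abs_of_nonpos (Set.mem_Iic.mp hx)]
  · refine (integrableOn_exp_mul_Ioi (neg_neg_of_pos hm) 0).congr_fun (fun x hx => ?_)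
      measurableSet_Ioi
    simp [abs_of_pos (Set.mem_Ioi.mp hx)]

/-- The integral of an integrable family of positive definite operators whose integrated
forms are coercive is an element of `Pos`, with the integrated form. -/
theorem Pos.exists_form_eq_integral {𝕜 H : Type*} [RCLike 𝕜] [NormedAddCommGroup H]
    [InnerProductSpace 𝕜 H] [CompleteSpace H] (P : ℝ → Pos 𝕜 H)
    (hP : MeasureTheory.Integrable fun x => (P x).op) {c : ℝ} (hc : 0 < c)
    (h : ∀ v, c * ‖v‖ ^ 2 ≤ ∫ x, (P x).form v) :
    ∃ m : Pos 𝕜 H, ∀ v, m.form v = ∫ x, (P x).form v := by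
  let _ : NormedSpace ℝ (H →L[𝕜] H) := NormedSpace.restrictScalars ℝ 𝕜 _
  set A : H →L[𝕜] H := ∫ x, (P x).op with hA
  have hin : ∀ v w : H, inner 𝕜 v (A w) = ∫ x, inner 𝕜 v ((P x).op w) := by
    intro v w
    exact (((innerSL 𝕜 v).comp (ContinuousLinearMap.apply 𝕜 H w)).integral_comp_comm hP).symm
  have hint : ∀ v w : H, MeasureTheory.Integrable fun x => inner 𝕜 v ((P x).op w) := by
    intro v w
    exact ((innerSL 𝕜 v).comp (ContinuousLinearMap.apply 𝕜 H w)).integrable_comp hP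
  have hform : ∀ v, RCLike.re (inner 𝕜 (A v) v) = ∫ x, (P x).form v := by
    intro v
    rw [inner_re_symm, hin, ← integral_re (hint v v)]
    congr 1
    funext x
    exact inner_re_symm _ _
  have hsa : IsSelfAdjoint A := by
    rw [ContinuousLinearMap.isSelfAdjoint_iff_isSymmetric]
    intro v w
    change inner 𝕜 (A v) w = inner 𝕜 v (A w)
    rw [← inner_conj_symm, hin, hin, ← integral_conj]
    congr 1
    funext x
    rw [inner_conj_symm]
    exact ContinuousLinearMap.isSelfAdjoint_iff_isSymmetric.mp (P x).isSelfAdjoint v w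
  exact ⟨⟨A, hsa, c, hc, fun v => by rw [hform]; exact h v⟩, hform⟩

namespace Pos

variable {𝕜 H : Type*} [RCLike 𝕜] [NormedAddCommGroup H] [InnerProductSpace 𝕜 H]
  [CompleteSpace H]

theorem form_one (v : H) : (1 : Pos 𝕜 H).form v = ‖v‖ ^ 2 := by
  unfold form
  rw [norm_sq_eq_re_inner (𝕜 := 𝕜)]
  rfl

theorem integrable_meanIntegrand {s : ℝ} (hs : s ∈ Set.Ioo (0 : ℝ) 1) (p q : Pos 𝕜 H) :
    MeasureTheory.Integrable fun x => (meanIntegrand s p q x).op := by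
  obtain ⟨C, hC⟩ := exists_norm_meanIntegrand_le s p q
  have hm : 0 < min s (1 - s) := lt_min hs.1 (by linarith [hs.2])
  exact ((integrable_exp_neg_mul_abs_real hm).const_mul C).mono'
    (continuous_meanIntegrand s p q).aestronglyMeasurable (Eventually.of_forall hC)

theorem integrable_form_meanIntegrand {s : ℝ} (hs : s ∈ Set.Ioo (0 : ℝ) 1) (p q : Pos 𝕜 H)
    (v : H) : MeasureTheory.Integrable fun x => (meanIntegrand s p q x).form v := by
  have h := ((ContinuousLinearMap.apply 𝕜 H v).integrable_comp
    (integrable_meanIntegrand hs p q)).inner_const (𝕜 := 𝕜) v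
  exact h.re

/-- The total mass `∫ e ^ (s x) / (1 + e ^ x) dx` of the kernel of the geometric mean. -/
noncomputable def meanMass (s : ℝ) : ℝ := ∫ x : ℝ, Real.exp (s * x - Real.log (1 + Real.exp x))

theorem meanMass_pos {s : ℝ} (hs : s ∈ Set.Ioo (0 : ℝ) 1) : 0 < meanMass s := by
  -- The kernel is the integrand for the mean of the number `1` with itself.
  have h := integrable_form_meanIntegrand hs (1 : Pos ℝ ℝ) 1 1
  simp only [meanIntegrand_self, form_dil, form_one, norm_one, one_pow, mul_one] at h
  unfold meanMass
  rw [MeasureTheory.integral_pos_iff_support_of_nonneg (fun x => (Real.exp_pos _).le) h]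
  have : Function.support (fun x : ℝ => Real.exp (s * x - Real.log (1 + Real.exp x))) =
      Set.univ := Set.eq_univ_of_forall fun x => (Real.exp_pos _).ne'
  rw [this]
  simp

/-- The integral `∫ e ^ (s x) (p⁻¹ + e ^ x q⁻¹)⁻¹ dx`, which is the weighted geometric mean of `p`
and `q` times `meanMass s`. -/
theorem exists_mean {s : ℝ} (hs : s ∈ Set.Ioo (0 : ℝ) 1) (p q : Pos 𝕜 H) :
    ∃ m : Pos 𝕜 H, ∀ v, meanMass s * m.form v = ∫ x, (meanIntegrand s p q x).form v := by
  have hK := meanMass_pos hs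
  obtain ⟨c, hc, hcp⟩ := p.coercive
  obtain ⟨d, hd, hdq⟩ := q.coercive
  -- A scalar operator below `p` and `q` bounds the integral below, since its mean with itself is
  -- known explicitly.
  set z : Pos 𝕜 H := dil (Real.log (min c d)) 1 with hz
  have hmin : 0 < min c d := lt_min hc hd
  have hzf : ∀ v, z.form v = min c d * ‖v‖ ^ 2 := fun v => by
    rw [hz, form_dil, form_one, Real.exp_log hmin]
  have hzp : ∀ v, z.form v ≤ p.form v := fun v => by
    rw [hzf]
    exact le_trans (by gcongr; exact min_le_left _ _) (hcp v)
  have hzq : ∀ v, z.form v ≤ q.form v := fun v => by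
    rw [hzf]
    exact le_trans (by gcongr; exact min_le_right _ _) (hdq v)
  obtain ⟨m, hm⟩ := exists_form_eq_integral (meanIntegrand s p q)
    (integrable_meanIntegrand hs p q) (c := meanMass s * min c d) (by positivity) fun v => by
      have h := MeasureTheory.integral_mono (integrable_form_meanIntegrand hs z z v)
        (integrable_form_meanIntegrand hs p q v) fun x => meanIntegrand_mono s hzp hzq x v
      refine le_trans (le_of_eq ?_) h
      simp only [meanIntegrand_self, form_dil, hzf]
      rw [MeasureTheory.integral_mul_const, meanMass]
      ring
  refine ⟨dil (-Real.log (meanMass s)) m, fun v => ?_⟩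
  rw [form_dil, ← hm, Real.exp_neg, Real.exp_log hK, mul_inv_cancel_left₀ hK.ne']

theorem integral_meanIntegrand_le {s : ℝ} (hs : s ∈ Set.Ioo (0 : ℝ) 1) {p q p' q' : Pos 𝕜 H}
    {a b : ℝ} (hp : ∀ v, p.form v ≤ Real.exp b * p'.form v)
    (hq : ∀ v, q.form v ≤ Real.exp a * q'.form v) (v : H) :
    ∫ x, (meanIntegrand s p q x).form v ≤
      Real.exp ((1 - s) * b + s * a) * ∫ x, (meanIntegrand s p' q' x).form v := by
  calc ∫ x, (meanIntegrand s p q x).form v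
      ≤ ∫ x, (meanIntegrand s (dil b p') (dil a q') x).form v :=
        MeasureTheory.integral_mono (integrable_form_meanIntegrand hs p q v)
          (integrable_form_meanIntegrand hs _ _ v) fun x =>
            meanIntegrand_mono s (fun w => by rw [form_dil]; exact hp w)
              (fun w => by rw [form_dil]; exact hq w) x v
    _ = _ := by
      simp only [meanIntegrand_dil, form_dil]
      rw [MeasureTheory.integral_const_mul, MeasureTheory.integral_add_right_eq_self
        (fun x => (meanIntegrand s p' q' x).form v)]

/-- The weighted geometric means are conical for the Thompson metric: they are increasing and
homogeneous of degrees `1 - s` and `s` in their two arguments. -/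
theorem hasConicalMeans : HasConicalMeans (Pos 𝕜 H) := by
  intro s hs
  have hK := meanMass_pos hs
  choose M hM using fun p q : Pos 𝕜 H => exists_mean hs p q
  refine ⟨M, fun z => ext_form fun v => ?_, ?_⟩
  · refine mul_left_cancel₀ hK.ne' ?_
    rw [hM]
    simp only [meanIntegrand_self, form_dil]
    rw [MeasureTheory.integral_mul_const, meanMass]
  · have key : ∀ p q p' q' v, (M p q).form v ≤
        Real.exp ((1 - s) * dist p p' + s * dist q q') * (M p' q').form v := by
      intro p q p' q' v
      refine le_of_mul_le_mul_left ?_ hK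
      rw [mul_left_comm, hM, hM]
      exact integral_meanIntegrand_le hs (form_le_exp_dist p p') (form_le_exp_dist q q') v
    intro p q p' q'
    have h1 : 0 ≤ 1 - s := by linarith [hs.2]
    have h2 : 0 ≤ s := hs.1.le
    refine dist_le_of_form_le (by positivity) (key p q p' q') fun v => ?_
    rw [dist_comm p, dist_comm q]
    exact key p' q' p q v

/-! ### Distances from the identity -/

theorem dist_one_add_one_le [Nontrivial H] (x : Pos 𝕜 H) :
    dist 1 x + 1 ≤ dist (dil 1 1) x ∨ dist 1 x + 1 ≤ dist (dil (-1) 1) x := by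
  have hv : ∀ v : H, v ≠ 0 → |Real.log (x.form v / (1 : Pos 𝕜 H).form v)| ≤
      max (dist (dil 1 1) x) (dist (dil (-1) 1) x) - 1 := by
    intro v hv
    have h1 := le_thompson (dil 1 1) x hv
    have h2 := le_thompson (dil (-1) 1) x hv
    have hpos := (1 : Pos 𝕜 H).form_pos hv
    rw [log_div _ _ hv, form_dil, Real.log_mul (Real.exp_pos _).ne' hpos.ne', Real.log_exp] at h1 h2
    rw [log_div _ _ hv]
    have h3 := h1.trans (le_max_left (dist (dil 1 1) x) (dist (dil (-1) 1) x))
    have h4 := h2.trans (le_max_right (dist (dil 1 1) x) (dist (dil (-1) 1) x))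
    rw [abs_le] at h3 h4 ⊢
    constructor <;> linarith
  obtain ⟨v, hv0⟩ := exists_ne (0 : H)
  have h : dist 1 x ≤ max (dist (dil 1 1) x) (dist (dil (-1) 1) x) - 1 :=
    thompson_le ((abs_nonneg _).trans (hv v hv0)) hv
  rcases max_choice (dist (dil 1 1) x) (dist (dil (-1) 1) x) with hm | hm
  · left; linarith
  · right; linarith

/-- Metric functionals of `Pos` are never constant: each of them is at least `1` at one of the two
scalar operators `e` and `e⁻¹`. -/
theorem exists_ne_of_mem_metricCompactification [Nontrivial H] {h : Pos 𝕜 H → ℝ}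
    (hh : h ∈ metricCompactification (Pos 𝕜 H) 1) : ∃ p q, h p ≠ h q := by
  have hc : IsClosed {f : Pos 𝕜 H → ℝ | 1 ≤ f (dil 1 1) ∨ 1 ≤ f (dil (-1) 1)} :=
    (isClosed_le continuous_const (continuous_apply _)).union
      (isClosed_le continuous_const (continuous_apply _))
  have hsub : Set.range (distFunctional (1 : Pos 𝕜 H)) ⊆
      {f : Pos 𝕜 H → ℝ | 1 ≤ f (dil 1 1) ∨ 1 ≤ f (dil (-1) 1)} := by
    rintro _ ⟨x, rfl⟩
    exact (dist_one_add_one_le x).imp (fun h => by simp only [distFunctional]; linarith)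
      (fun h => by simp only [distFunctional]; linarith)
  have h0 := metricCompactification_apply_base hh
  rcases closure_minimal hsub hc hh with h1 | h1
  · exact ⟨dil 1 1, 1, by rw [h0]; linarith⟩
  · exact ⟨dil (-1) 1, 1, by rw [h0]; linarith⟩

theorem form_smul_op (g : (H →L[𝕜] H)ˣ) (p : Pos 𝕜 H) (v : H) :
    (g • p).form v = p.form (ContinuousLinearMap.adjoint (g : H →L[𝕜] H) v) :=
  form_conj g p v

theorem norm_mul_star_unit (k : (H →L[𝕜] H)ˣ) :
    ‖((k * star k : (H →L[𝕜] H)ˣ) : H →L[𝕜] H)‖ = ‖(k : H →L[𝕜] H)‖ ^ 2 := by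
  rw [Units.val_mul, Units.coe_star, CStarRing.norm_self_mul_star, sq]

theorem norm_inv_mul_star_unit (k : (H →L[𝕜] H)ˣ) :
    ‖(((k * star k)⁻¹ : (H →L[𝕜] H)ˣ) : H →L[𝕜] H)‖ =
      ‖((k⁻¹ : (H →L[𝕜] H)ˣ) : H →L[𝕜] H)‖ ^ 2 := by
  rw [mul_inv_rev, ← star_inv, Units.val_mul, Units.coe_star, CStarRing.norm_star_mul_self, sq]

theorem form_smul_one_le (k : (H →L[𝕜] H)ˣ) (v : H) :
    (k • (1 : Pos 𝕜 H)).form v ≤ ‖(k : H →L[𝕜] H)‖ ^ 2 * (1 : Pos 𝕜 H).form v := by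
  rw [form_smul_op, form_one, form_one, ← mul_pow]
  gcongr
  rw [← ContinuousLinearMap.star_eq_adjoint, ← norm_star (k : H →L[𝕜] H)]
  exact ContinuousLinearMap.le_opNorm _ _

theorem norm_sq_le_of_form_le (k : (H →L[𝕜] H)ˣ) {C : ℝ} (hC : 0 ≤ C)
    (h : ∀ v, (k • (1 : Pos 𝕜 H)).form v ≤ C * (1 : Pos 𝕜 H).form v) :
    ‖(k : H →L[𝕜] H)‖ ^ 2 ≤ C := by
  have h1 : ‖(k : H →L[𝕜] H)‖ ≤ √C := by
    rw [← norm_star (k : H →L[𝕜] H)]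
    refine ContinuousLinearMap.opNorm_le_bound _ (Real.sqrt_nonneg C) fun v => ?_
    have := h v
    rw [form_smul_op, form_one, form_one] at this
    rw [ContinuousLinearMap.star_eq_adjoint]
    refine le_of_sq_le_sq ?_ (by positivity)
    rwa [mul_pow, Real.sq_sqrt hC]
  calc ‖(k : H →L[𝕜] H)‖ ^ 2 ≤ √C ^ 2 := by gcongr
    _ = C := Real.sq_sqrt hC

theorem form_le_form_smul_one (k : (H →L[𝕜] H)ˣ) (v : H) :
    (1 : Pos 𝕜 H).form v ≤
      ‖((k⁻¹ : (H →L[𝕜] H)ˣ) : H →L[𝕜] H)‖ ^ 2 * (k • (1 : Pos 𝕜 H)).form v := by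
  have h := form_smul_one_le k⁻¹ (ContinuousLinearMap.adjoint (k : H →L[𝕜] H) v)
  rwa [← form_smul_op, ← form_smul_op, smul_inv_smul] at h

theorem dist_one_smul_one [Nontrivial H] (k : (H →L[𝕜] H)ˣ) :
    dist 1 (k • (1 : Pos 𝕜 H)) =
      max (Real.log ‖((k * star k : (H →L[𝕜] H)ˣ) : H →L[𝕜] H)‖)
        (Real.log ‖(((k * star k)⁻¹ : (H →L[𝕜] H)ˣ) : H →L[𝕜] H)‖) := by
  rw [norm_mul_star_unit, norm_inv_mul_star_unit]
  have hk := Units.norm_pos k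
  have hk' := Units.norm_pos k⁻¹
  apply le_antisymm
  · refine dist_le_of_form_le ?_ (fun v => ?_) fun v => ?_
    · have h1 : 1 ≤ ‖(k : H →L[𝕜] H)‖ * ‖((k⁻¹ : (H →L[𝕜] H)ˣ) : H →L[𝕜] H)‖ := by
        calc (1 : ℝ) = ‖(1 : H →L[𝕜] H)‖ := norm_one.symm
          _ = ‖(k : H →L[𝕜] H) * ((k⁻¹ : (H →L[𝕜] H)ˣ) : H →L[𝕜] H)‖ := by rw [Units.mul_inv]
          _ ≤ _ := norm_mul_le _ _
      have h2 := Real.log_nonneg h1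
      rw [Real.log_mul hk.ne' hk'.ne'] at h2
      rw [Real.log_pow, Real.log_pow, le_max_iff]
      push_cast
      by_contra! h
      linarith [h.1, h.2]
    · refine (form_le_form_smul_one k v).trans ?_
      gcongr
      · exact form_nonneg _ v
      · rw [← Real.log_le_iff_le_exp (by positivity)]
        exact le_max_right _ _
    · refine (form_smul_one_le k v).trans ?_
      gcongr
      · exact form_nonneg _ v
      · rw [← Real.log_le_iff_le_exp (by positivity)]
        exact le_max_left _ _
  · rw [max_le_iff, Real.log_le_iff_le_exp (by positivity), Real.log_le_iff_le_exp (by positivity)]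
    constructor
    · refine norm_sq_le_of_form_le k (Real.exp_pos _).le fun v => ?_
      rw [dist_comm]
      exact form_le_exp_dist _ _ v
    · refine norm_sq_le_of_form_le k⁻¹ (Real.exp_pos _).le fun v => ?_
      have h : dist 1 (k • (1 : Pos 𝕜 H)) = dist (k⁻¹ • (1 : Pos 𝕜 H)) 1 := by
        rw [← dist_smul k⁻¹, inv_smul_smul]
      rw [h]
      exact form_le_exp_dist _ _ v

theorem dist_smul_eq_iSup [Nontrivial H] (g : (H →L[𝕜] H)ˣ) (p : Pos 𝕜 H) :
    dist p (g • p) = ⨆ v : {v : H // v ≠ 0},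
      |Real.log (p.form (ContinuousLinearMap.adjoint (g : H →L[𝕜] H) v) / p.form v)| := by
  have hle : ∀ v : {v : H // v ≠ 0},
      |Real.log (p.form (ContinuousLinearMap.adjoint (g : H →L[𝕜] H) v) / p.form v)| ≤
        dist p (g • p) := fun v => by
    rw [← form_smul_op]
    exact le_thompson p (g • p) v.2
  have hb : BddAbove (Set.range fun v : {v : H // v ≠ 0} =>
      |Real.log (p.form (ContinuousLinearMap.adjoint (g : H →L[𝕜] H) v) / p.form v)|) :=
    ⟨_, Set.forall_mem_range.mpr hle⟩
  apply le_antisymm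
  · refine thompson_le (Real.iSup_nonneg fun _ => abs_nonneg _) fun v hv => ?_
    rw [form_smul_op]
    exact le_ciSup hb ⟨v, hv⟩
  · obtain ⟨v, hv⟩ := exists_ne (0 : H)
    have : Nonempty {v : H // v ≠ 0} := ⟨⟨v, hv⟩⟩
    exact ciSup_le hle

/-! ### The one-sided displacement and the spectral radius -/

/-- The largest value of the ratio of the forms of `g • p` and `p`. -/
noncomputable def maxRatio (g : (H →L[𝕜] H)ˣ) (p : Pos 𝕜 H) : ℝ :=
  ⨆ v : {v : H // v ≠ 0}, p.form (ContinuousLinearMap.adjoint (g : H →L[𝕜] H) v) / p.form v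

theorem bddAbove_ratio (g : (H →L[𝕜] H)ˣ) (p : Pos 𝕜 H) :
    BddAbove (Set.range fun v : {v : H // v ≠ 0} =>
      p.form (ContinuousLinearMap.adjoint (g : H →L[𝕜] H) v) / p.form v) := by
  refine ⟨Real.exp (dist (g • p) p), ?_⟩
  rintro _ ⟨v, rfl⟩
  change p.form (ContinuousLinearMap.adjoint (g : H →L[𝕜] H) v) / p.form v ≤ _
  rw [div_le_iff₀ (p.form_pos v.2), ← form_smul_op]
  exact form_le_exp_dist _ _ _

theorem maxRatio_pos [Nontrivial H] (g : (H →L[𝕜] H)ˣ) (p : Pos 𝕜 H) : 0 < maxRatio g p := by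
  obtain ⟨v, hv⟩ := exists_ne (0 : H)
  refine lt_of_lt_of_le ?_ (le_ciSup (bddAbove_ratio g p) ⟨v, hv⟩)
  rw [← form_smul_op]
  exact div_pos (form_pos _ hv) (form_pos _ hv)

theorem form_smul_le_maxRatio (g : (H →L[𝕜] H)ˣ) (p : Pos 𝕜 H) (v : H) :
    (g • p).form v ≤ maxRatio g p * p.form v := by
  by_cases hv : v = 0
  · simp [hv, form]
  rw [← div_le_iff₀ (p.form_pos hv), form_smul_op]
  exact le_ciSup (bddAbove_ratio g p) ⟨v, hv⟩

theorem maxRatio_le [Nontrivial H] {g : (H →L[𝕜] H)ˣ} {p : Pos 𝕜 H} {C : ℝ}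
    (h : ∀ v, (g • p).form v ≤ C * p.form v) : maxRatio g p ≤ C := by
  obtain ⟨v, hv⟩ := exists_ne (0 : H)
  have : Nonempty {v : H // v ≠ 0} := ⟨⟨v, hv⟩⟩
  refine ciSup_le fun w => ?_
  rw [div_le_iff₀ (p.form_pos w.2), ← form_smul_op]
  exact h w

theorem log_norm_pow_le [Nontrivial H] (g : (H →L[𝕜] H)ˣ) (p : Pos 𝕜 H) (n : ℕ) :
    Real.log (‖((g ^ n : (H →L[𝕜] H)ˣ) : H →L[𝕜] H)‖ ^ 2) ≤
      2 * dist 1 p + n * Real.log (maxRatio g p) := by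
  have hS := maxRatio_pos g p
  have hit : ∀ v, (g ^ n • p).form v ≤ maxRatio g p ^ n * p.form v := by
    induction n with
    | zero => simp
    | succ n ih =>
      intro v
      rw [pow_succ', mul_smul, form_smul_op]
      refine (ih _).trans ?_
      rw [← form_smul_op, pow_succ, mul_assoc]
      gcongr
      exact form_smul_le_maxRatio g p v
  have hb : ‖((g ^ n : (H →L[𝕜] H)ˣ) : H →L[𝕜] H)‖ ^ 2 ≤
      Real.exp (2 * dist 1 p) * maxRatio g p ^ n := by
    refine norm_sq_le_of_form_le _ (by positivity) fun v => ?_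
    have h1 := form_le_exp_dist (g ^ n • 1) (g ^ n • p) v
    rw [dist_smul] at h1
    have h2 := form_le_exp_dist p 1 v
    rw [dist_comm] at h2
    calc (g ^ n • (1 : Pos 𝕜 H)).form v ≤ Real.exp (dist 1 p) * (g ^ n • p).form v := h1
      _ ≤ Real.exp (dist 1 p) * (maxRatio g p ^ n *
          (Real.exp (dist 1 p) * (1 : Pos 𝕜 H).form v)) := by
        gcongr
        refine (hit v).trans ?_
        gcongr
      _ = _ := by rw [two_mul, Real.exp_add]; ring
  have hpos : 0 < ‖((g ^ n : (H →L[𝕜] H)ˣ) : H →L[𝕜] H)‖ := Units.norm_pos _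
  refine (Real.log_le_log (by positivity) hb).trans (le_of_eq ?_)
  rw [Real.log_mul (by positivity) (by positivity), Real.log_exp, Real.log_pow]

/-- The operator `∑ k ≤ n, e ^ (-k σ) g ^ k (g ^ k)*`. -/
noncomputable def orbitSum (g : (H →L[𝕜] H)ˣ) (σ : ℝ) : ℕ → Pos 𝕜 H
  | 0 => 1
  | n + 1 => orbitSum g σ n + dil (-((n + 1 : ℕ) * σ)) (g ^ (n + 1) • (1 : Pos 𝕜 H))

/-- Conjugation by `g` shifts the summands of the orbit sum, so that the difference between
`g • p` and `e ^ σ p` telescopes to the first and last terms. -/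
theorem form_smul_orbitSum (g : (H →L[𝕜] H)ˣ) (σ : ℝ) (n : ℕ) (v : H) :
    (g • orbitSum g σ n).form v + Real.exp σ * (1 : Pos 𝕜 H).form v =
      Real.exp σ * ((orbitSum g σ n).form v +
        Real.exp (-((n + 1 : ℕ) * σ)) * (g ^ (n + 1) • (1 : Pos 𝕜 H)).form v) := by
  induction n with
  | zero =>
    have : Real.exp σ * Real.exp (-((0 + 1 : ℕ) * σ)) = 1 := by
      rw [← Real.exp_add]; simp
    rw [mul_add, ← mul_assoc, this, one_mul, zero_add, pow_one, orbitSum, add_comm]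
  | succ n ih =>
    have e1 : Real.exp (-((n + 1 : ℕ) * σ)) =
        Real.exp σ * Real.exp (-((n + 1 + 1 : ℕ) * σ)) := by
      rw [← Real.exp_add]
      congr 1
      push_cast
      ring
    have e2 : (g ^ (n + 1 + 1) • (1 : Pos 𝕜 H)).form v = (g ^ (n + 1) • (1 : Pos 𝕜 H)).form
        (ContinuousLinearMap.adjoint (g : H →L[𝕜] H) v) := by
      rw [pow_succ' g (n + 1), mul_smul, form_smul_op]
    rw [form_smul_op] at ih ⊢
    rw [orbitSum, form_add, form_add, form_dil, form_dil, ← e2, add_right_comm, ih, e1]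
    ring

/-- For some `p`, the one-sided displacement of `p` is at most the mean growth rate of the first
`n` powers of `g`. -/
theorem exists_log_maxRatio_le [Nontrivial H] (g : (H →L[𝕜] H)ˣ) (n : ℕ) :
    ∃ p : Pos 𝕜 H, Real.log (maxRatio g p) ≤
      Real.log (‖((g ^ (n + 1) : (H →L[𝕜] H)ˣ) : H →L[𝕜] H)‖ ^ 2) / (n + 1 : ℕ) := by
  set N := ‖((g ^ (n + 1) : (H →L[𝕜] H)ˣ) : H →L[𝕜] H)‖ with hN
  have hNpos : 0 < N := Units.norm_pos _
  set σ := Real.log (N ^ 2) / (n + 1 : ℕ) with hσ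
  refine ⟨orbitSum g σ n, ?_⟩
  rw [Real.log_le_iff_le_exp (maxRatio_pos _ _)]
  refine maxRatio_le fun v => ?_
  have h1 := form_smul_orbitSum g σ n v
  have h2 : Real.exp (-((n + 1 : ℕ) * σ)) * (g ^ (n + 1) • (1 : Pos 𝕜 H)).form v ≤
      (1 : Pos 𝕜 H).form v := by
    rw [hσ, mul_div_cancel₀ _ (by positivity), Real.exp_neg, Real.exp_log (by positivity),
      inv_mul_le_iff₀ (by positivity)]
    exact form_smul_one_le _ v
  have h3 := mul_le_mul_of_nonneg_left h2 (Real.exp_pos σ).le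
  rw [mul_add] at h1
  linarith

/-- The spectral radius formula for the one-sided displacement. -/
theorem tendsto_log_norm_pow [Nontrivial H] (g : (H →L[𝕜] H)ˣ) :
    Tendsto (fun n : ℕ => Real.log (‖((g ^ n : (H →L[𝕜] H)ˣ) : H →L[𝕜] H)‖ ^ 2) / n) atTop
      (𝓝 (⨅ p : Pos 𝕜 H, Real.log (maxRatio g p))) := by
  set u : ℕ → ℝ := fun n => Real.log (‖((g ^ n : (H →L[𝕜] H)ˣ) : H →L[𝕜] H)‖ ^ 2) with hu
  have hpos : ∀ n, 0 < ‖((g ^ n : (H →L[𝕜] H)ˣ) : H →L[𝕜] H)‖ := fun n => Units.norm_pos _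
  have hsub : Subadditive u := by
    intro m n
    have hm := hpos m
    have hn := hpos n
    have hmn := hpos (m + n)
    simp only [hu]
    rw [← Real.log_mul (by positivity) (by positivity), ← mul_pow]
    refine Real.log_le_log (by positivity) ?_
    gcongr
    rw [pow_add, Units.val_mul]
    exact norm_mul_le _ _
  have hbdd : BddBelow (Set.range fun n => u n / n) := by
    set N := ‖((g⁻¹ : (H →L[𝕜] H)ˣ) : H →L[𝕜] H)‖ with hN
    have hNpos : 0 < N := Units.norm_pos _
    refine ⟨-|2 * Real.log N|, ?_⟩
    rintro _ ⟨n, rfl⟩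
    rcases Nat.eq_zero_or_pos n with rfl | hn
    · simp
    have hn' : (0 : ℝ) < n := by exact_mod_cast hn
    have hg := hpos n
    have h1 : 1 ≤ ‖((g ^ n : (H →L[𝕜] H)ˣ) : H →L[𝕜] H)‖ * N ^ n := by
      calc (1 : ℝ) = ‖(1 : H →L[𝕜] H)‖ := norm_one.symm
        _ = ‖((g ^ n : (H →L[𝕜] H)ˣ) : H →L[𝕜] H) *
            ((g⁻¹ : (H →L[𝕜] H)ˣ) : H →L[𝕜] H) ^ n‖ := by
          rw [← Units.val_pow_eq_pow_val, ← Units.val_mul, inv_pow, mul_inv_cancel, Units.val_one]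
        _ ≤ _ := (norm_mul_le _ _).trans (by gcongr; exact norm_pow_le _ _)
    have h2 := Real.log_nonneg h1
    rw [Real.log_mul hg.ne' (by positivity), Real.log_pow] at h2
    simp only [hu]
    rw [le_div_iff₀ hn', Real.log_pow]
    have h3 := mul_le_mul_of_nonneg_right (le_abs_self (2 * Real.log N)) hn'.le
    rw [Nat.cast_ofNat]
    linarith
  have hlim := hsub.tendsto_lim hbdd
  have hlow : ∀ p : Pos 𝕜 H, hsub.lim ≤ Real.log (maxRatio g p) := by
    intro p
    have ht : Tendsto (fun n : ℕ => 2 * dist 1 p * (1 / (n : ℝ)) + Real.log (maxRatio g p)) atTop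
        (𝓝 (Real.log (maxRatio g p))) := by
      simpa using ((tendsto_one_div_atTop_nhds_zero_nat (𝕜 := ℝ)).const_mul
        (2 * dist 1 p)).add_const (Real.log (maxRatio g p))
    refine le_of_tendsto_of_tendsto hlim ht ?_
    filter_upwards [eventually_gt_atTop 0] with n hn
    have hn' : (0 : ℝ) < n := by exact_mod_cast hn
    rw [div_le_iff₀ hn']
    have := log_norm_pow_le g p n
    field_simp
    linarith
  have heq : ⨅ p : Pos 𝕜 H, Real.log (maxRatio g p) = hsub.lim := by
    refine le_antisymm ?_ (le_ciInf hlow)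
    refine ge_of_tendsto ((tendsto_add_atTop_iff_nat 1).mpr hlim) (Eventually.of_forall fun n => ?_)
    obtain ⟨p, hp⟩ := exists_log_maxRatio_le g n
    exact (ciInf_le ⟨_, Set.forall_mem_range.mpr hlow⟩ p).trans hp
  rw [heq]
  exact hlim

end Pos

theorem theorem1p10 {𝕜 H : Type*} [RCLike 𝕜] [NormedAddCommGroup H] [InnerProductSpace 𝕜 H]
    [CompleteSpace H] [Nontrivial H] (g : (H →L[𝕜] H)ˣ) :
    -- an invariant nonconstant metric functional, fixed by `g`
    (∃ h ∈ metricCompactification (Pos 𝕜 H) 1,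
      (∃ p q, h p ≠ h q) ∧
      isometryAct 1 (IsometryEquiv.constSMul g) h = h ∧
      ∀ p : Pos 𝕜 H, h (g • p) = h p - ⨅ q : Pos 𝕜 H, dist q (g • q)) ∧
    -- minimal displacement equals translation number
    Tendsto (fun n : ℕ => (1 / (n : ℝ)) *
        max (Real.log ‖((g ^ n * star g ^ n : (H →L[𝕜] H)ˣ) : H →L[𝕜] H)‖)
          (Real.log ‖(((g ^ n * star g ^ n)⁻¹ : (H →L[𝕜] H)ˣ) : H →L[𝕜] H)‖))
      atTop
      (𝓝 (⨅ p : Pos 𝕜 H, ⨆ v : {v : H // v ≠ 0},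
        |Real.log (p.form (ContinuousLinearMap.adjoint (g : H →L[𝕜] H) v) / p.form v)|)) ∧
    -- the one-sided equality, with the supremum inside the logarithm
    Tendsto (fun n : ℕ => (1 / (n : ℝ)) *
        Real.log ‖((g ^ n * star g ^ n : (H →L[𝕜] H)ˣ) : H →L[𝕜] H)‖)
      atTop
      (𝓝 (⨅ p : Pos 𝕜 H, Real.log (⨆ v : {v : H // v ≠ 0},
        p.form (ContinuousLinearMap.adjoint (g : H →L[𝕜] H) v) / p.form v))) := by
  obtain ⟨h, hh, hT⟩ :=
    Pos.hasConicalMeans.exists_metricFunctional (1 : Pos 𝕜 H) (IsometryEquiv.constSMul g)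
  have hT' : ∀ p : Pos 𝕜 H, h (g • p) = h p - ⨅ q : Pos 𝕜 H, dist q (g • q) := hT
  refine ⟨⟨h, hh, Pos.exists_ne_of_mem_metricCompactification hh, ?_, hT'⟩, ?_, ?_⟩
  · funext p
    have h0 := metricCompactification_apply_base hh
    have h1 := hT' (g⁻¹ • p)
    have h2 := hT' (g⁻¹ • 1)
    rw [smul_inv_smul] at h1 h2
    change h (g⁻¹ • p) - h (g⁻¹ • 1) = h p
    linarith
  · simp only [← Pos.dist_smul_eq_iSup]
    refine (tendsto_dist_iterate_div (IsometryEquiv.constSMul g) hh hT).congr fun n => ?_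
    have hi : (IsometryEquiv.constSMul g)^[n] (1 : Pos 𝕜 H) = g ^ n • 1 :=
      smul_iterate_apply g n 1
    rw [hi, Pos.dist_one_smul_one, star_pow]
  · refine (Pos.tendsto_log_norm_pow g).congr fun n => ?_
    rw [← star_pow, Pos.norm_mul_star_unit, one_div_mul_eq_div]
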